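/- Let $k$ be a field and let $H$ be a Hopf algebra over $k$ whose coradical $H_0$ (the sum of all simple subcoalgebras of $H$) is a Hopf subalgebra, i.e. a subalgebra and a subcoalgebra of $H$ that is stable under the antipode. Let $E$ be the injective envelope, in the category of left $H$-comodules, of the trivial comodule $k$ (with coaction $c\mapsto 1\otimes c$). Then for every simple left $H$-comodule $S$, with injective envelope $E(S)$ in the category of left $H$-comodules, there is an isomorphism of left $H$-comodules $$E(S)\;\cong\;E\otimes S,$$ where $E\otimes S$ carries the diagonal coaction $e\otimes s\mapsto \sum e_{(-1)}s_{(-1)}\otimes (e_{(0)}\otimes s_{(0)})$. -/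

import Mathlib

open scoped TensorProduct

universe u v w w'

noncomputable section

/-- A left comodule over the `k`-coalgebra `C`: a `k`-vector space `M` with a linear map
`coact : M → C ⊗ M` that is coassociative and counital. -/
class LeftComodule (k : Type u) (C : Type v) (M : Type w) [Field k] [AddCommMonoid C] [Module k C]
    [Coalgebra k C] [AddCommGroup M] [Module k M] where
  /-- The coaction `m ↦ ∑ m₍₋₁₎ ⊗ m₍₀₎`. -/
  coact : M →ₗ[k] C ⊗[k] M
  /-- `(Δ ⊗ id) ∘ coact = (id ⊗ coact) ∘ coact`. -/
  coassoc : (TensorProduct.assoc k C C M).toLinearMap ∘ₗ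
      (Coalgebra.comul (R := k) (A := C)).rTensor M ∘ₗ coact = coact.lTensor C ∘ₗ coact
  /-- `(ε ⊗ id) ∘ coact = id`, under the identification of `k ⊗ M` with `M`. -/
  counit_coact : (TensorProduct.lid k M).toLinearMap ∘ₗ
      (Coalgebra.counit (R := k) (A := C)).rTensor M ∘ₗ coact = LinearMap.id

namespace LeftComodule

section Coalgebra

variable (k : Type u) (C : Type v) [Field k] [AddCommMonoid C] [Module k C] [Coalgebra k C]

/-- Morphisms of left `C`-comodules: `coact ∘ f = (id ⊗ f) ∘ coact`. -/
def IsHom {M : Type w} {N : Type w'} [AddCommGroup M] [Module k M] [LeftComodule k C M]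
    [AddCommGroup N] [Module k N] [LeftComodule k C N] (f : M →ₗ[k] N) : Prop :=
  coact (k := k) (C := C) ∘ₗ f = f.lTensor C ∘ₗ coact (k := k) (C := C)

/-- `N ⊆ M` is a subcomodule: the coaction of `M` maps `N` into `C ⊗ N`, seen in `C ⊗ M`. -/
def IsSubcomodule {M : Type w} [AddCommGroup M] [Module k M] [LeftComodule k C M]
    (N : Submodule k M) : Prop :=
  ∀ n ∈ N, coact (k := k) (C := C) n ∈ LinearMap.range (N.subtype.lTensor C)

/-- A simple left comodule: it is nonzero, and its only subcomodules are zero and itself. -/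
def IsSimple (M : Type w) [AddCommGroup M] [Module k M] [LeftComodule k C M] : Prop :=
  Nontrivial M ∧ ∀ N : Submodule k M, IsSubcomodule k C N → N = ⊥ ∨ N = ⊤

/-- An injective object of the category of left `C`-comodules: every comodule map from `X` into
it extends along every injective comodule map `X → Y`. -/
def IsInjective (E : Type w) [AddCommGroup E] [Module k E] [LeftComodule k C E] : Prop :=
  ∀ (X Y : Type w) [AddCommGroup X] [Module k X] [LeftComodule k C X]
    [AddCommGroup Y] [Module k Y] [LeftComodule k C Y] (f : X →ₗ[k] Y) (g : X →ₗ[k] E),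
    IsHom k C f → Function.Injective f → IsHom k C g →
      ∃ h : Y →ₗ[k] E, IsHom k C h ∧ h ∘ₗ f = g

/-- `i : M → E` is an injective envelope of `M` in the category of left `C`-comodules: `E` is
injective, and `i` is an injective comodule map with essential image, that is, every nonzero
subcomodule of `E` meets the image of `i` nontrivially. -/
structure IsInjectiveEnvelope {M : Type w} {E : Type w'} [AddCommGroup M] [Module k M]
    [LeftComodule k C M] [AddCommGroup E] [Module k E] [LeftComodule k C E]
    (i : M →ₗ[k] E) : Prop where
  isInjective : IsInjective k C E
  isHom : IsHom k C i
  injective : Function.Injective i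
  essential : ∀ N : Submodule k E, IsSubcomodule k C N → N ≠ ⊥ → N ⊓ LinearMap.range i ≠ ⊥

end Coalgebra

section Bialgebra

variable (k : Type u) (H : Type v) [Field k] [Ring H] [Bialgebra k H]

/-- The trivial left comodule `k`, with coaction `c ↦ 1 ⊗ c`. -/
instance trivial : LeftComodule k H k where
  coact := TensorProduct.mk k H k 1
  coassoc := by
    ext
    simp [Algebra.TensorProduct.one_def]
  counit_coact := by
    ext
    simp

/-- The linear map `(H ⊗ M) ⊗ (H ⊗ N) → H ⊗ (M ⊗ N)`,
`(a ⊗ m) ⊗ (b ⊗ n) ↦ a b ⊗ (m ⊗ n)`. -/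
def mulMap (M : Type w) (N : Type w') [AddCommMonoid M] [Module k M] [AddCommMonoid N]
    [Module k N] : (H ⊗[k] M) ⊗[k] (H ⊗[k] N) →ₗ[k] H ⊗[k] (M ⊗[k] N) :=
  (LinearMap.mul' k H).rTensor (M ⊗[k] N) ∘ₗ
    (TensorProduct.tensorTensorTensorComm k H M H N).toLinearMap

variable (M : Type w) (N : Type w') [AddCommGroup M] [Module k M] [AddCommGroup N] [Module k N]

theorem mulMap_tmul (a b : H) (m : M) (n : N) :
    mulMap k H M N ((a ⊗ₜ m) ⊗ₜ (b ⊗ₜ n)) = (a * b) ⊗ₜ (m ⊗ₜ n) := by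
  simp [mulMap]

theorem counit_mulMap (x : H ⊗[k] M) (y : H ⊗[k] N) :
    TensorProduct.lid k (M ⊗[k] N) ((Coalgebra.counit (R := k) (A := H)).rTensor (M ⊗[k] N)
      (mulMap k H M N (x ⊗ₜ y))) =
    TensorProduct.lid k M ((Coalgebra.counit (R := k) (A := H)).rTensor M x) ⊗ₜ
      TensorProduct.lid k N ((Coalgebra.counit (R := k) (A := H)).rTensor N y) := by
  induction x with
  | zero => simp
  | add x x' hx hx' => simp only [TensorProduct.add_tmul, map_add, hx, hx']
  | tmul a m =>
    induction y with
    | zero => simp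
    | add y y' hy hy' => simp only [TensorProduct.tmul_add, map_add, hy, hy']
    | tmul b n =>
      simp [mulMap_tmul, TensorProduct.smul_tmul', smul_smul, mul_comm]

theorem assoc_comul_mulMap (x : H ⊗[k] M) (y : H ⊗[k] N) :
    TensorProduct.assoc k H H (M ⊗[k] N) ((Coalgebra.comul (R := k) (A := H)).rTensor (M ⊗[k] N)
      (mulMap k H M N (x ⊗ₜ y))) =
    (mulMap k H M N).lTensor H (mulMap k H (H ⊗[k] M) (H ⊗[k] N)
      (TensorProduct.assoc k H H M ((Coalgebra.comul (R := k) (A := H)).rTensor M x) ⊗ₜ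
        TensorProduct.assoc k H H N ((Coalgebra.comul (R := k) (A := H)).rTensor N y))) := by
  induction x with
  | zero => simp
  | add x x' hx hx' => simp only [TensorProduct.add_tmul, map_add, hx, hx']
  | tmul a m =>
    induction y with
    | zero => simp
    | add y y' hy hy' => simp only [TensorProduct.tmul_add, map_add, hy, hy']
    | tmul b n =>
      simp only [mulMap_tmul, LinearMap.rTensor_tmul, Bialgebra.comul_mul]
      generalize Coalgebra.comul (R := k) a = p
      generalize Coalgebra.comul (R := k) b = q
      induction p with
      | zero => simp
      | add p p' hp hp' => simp only [add_mul, TensorProduct.add_tmul, map_add, hp, hp']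
      | tmul p p' =>
        induction q with
        | zero => simp
        | add q q' hq hq' =>
          simp only [mul_add, TensorProduct.add_tmul, TensorProduct.tmul_add, map_add, hq, hq']
        | tmul q q' => simp [mulMap_tmul]

variable [LeftComodule k H M] [LeftComodule k H N]

/-- The diagonal coaction on `M ⊗ N`,
`m ⊗ n ↦ ∑ m₍₋₁₎ n₍₋₁₎ ⊗ (m₍₀₎ ⊗ n₍₀₎)`. -/
def tensorCoact : M ⊗[k] N →ₗ[k] H ⊗[k] (M ⊗[k] N) :=
  mulMap k H M N ∘ₗ TensorProduct.map (coact (k := k) (C := H)) (coact (k := k) (C := H))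

theorem lTensor_tensorCoact_mulMap (x : H ⊗[k] M) (y : H ⊗[k] N) :
    (tensorCoact k H M N).lTensor H (mulMap k H M N (x ⊗ₜ y)) =
    (mulMap k H M N).lTensor H (mulMap k H (H ⊗[k] M) (H ⊗[k] N)
      ((coact (k := k) (C := H)).lTensor H x ⊗ₜ (coact (k := k) (C := H)).lTensor H y)) := by
  induction x with
  | zero => simp
  | add x x' hx hx' => simp only [TensorProduct.add_tmul, map_add, hx, hx']
  | tmul a m =>
    induction y with
    | zero => simp
    | add y y' hy hy' => simp only [TensorProduct.tmul_add, map_add, hy, hy']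
    | tmul b n => simp [mulMap_tmul, tensorCoact]

/-- The tensor product of two left comodules over a bialgebra, with the diagonal coaction. -/
instance tensor : LeftComodule k H (M ⊗[k] N) where
  coact := tensorCoact k H M N
  coassoc := by
    ext m n
    have hm := LinearMap.congr_fun (coassoc (k := k) (C := H) (M := M)) m
    have hn := LinearMap.congr_fun (coassoc (k := k) (C := H) (M := N)) n
    simp only [LinearMap.comp_apply, LinearEquiv.coe_coe] at hm hn
    have h1 := assoc_comul_mulMap k H M N (coact m) (coact n)
    have h2 := lTensor_tensorCoact_mulMap k H M N (coact m) (coact n)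
    rw [hm, hn, ← h2] at h1
    simpa [tensorCoact] using h1
  counit_coact := by
    ext m n
    have hm := LinearMap.congr_fun (counit_coact (k := k) (C := H) (M := M)) m
    have hn := LinearMap.congr_fun (counit_coact (k := k) (C := H) (M := N)) n
    simp only [LinearMap.comp_apply, LinearEquiv.coe_coe] at hm hn
    have h1 := counit_mulMap k H M N (coact m) (coact n)
    rw [hm, hn] at h1
    simpa [tensorCoact] using h1

end Bialgebra

end LeftComodule

section Coradical

variable (k : Type u) (C : Type v) [Field k] [AddCommGroup C] [Module k C] [Coalgebra k C]

/-- `D ⊆ C` is a subcoalgebra: `Δ(D) ⊆ D ⊗ D`, seen in `C ⊗ C`. -/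
def IsSubcoalgebra {C : Type v} [AddCommGroup C] [Module k C] [Coalgebra k C]
    (D : Submodule k C) : Prop :=
  ∀ d ∈ D, Coalgebra.comul (R := k) d ∈ LinearMap.range (TensorProduct.map D.subtype D.subtype)

/-- A simple subcoalgebra: a nonzero subcoalgebra whose only subcoalgebras are zero and itself. -/
def IsSimpleSubcoalgebra {C : Type v} [AddCommGroup C] [Module k C] [Coalgebra k C]
    (D : Submodule k C) : Prop :=
  IsSubcoalgebra k D ∧ D ≠ ⊥ ∧
    ∀ D' : Submodule k C, IsSubcoalgebra k D' → D' ≤ D → D' = ⊥ ∨ D' = D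

/-- The coradical `C₀` of a coalgebra: the sum of all its simple subcoalgebras. -/
def coradical : Submodule k C :=
  sSup {D : Submodule k C | IsSimpleSubcoalgebra k D}

end Coradical

/-- A Hopf subalgebra of a Hopf algebra: a linear subspace that is a subalgebra (with the same
unit) and a subcoalgebra, and that is stable under the antipode. -/
structure IsHopfSubalgebra (k : Type u) {H : Type v} [Field k] [Ring H] [HopfAlgebra k H]
    (A : Submodule k H) : Prop where
  one_mem : (1 : H) ∈ A
  mul_mem : ∀ a ∈ A, ∀ b ∈ A, a * b ∈ A
  isSubcoalgebra : IsSubcoalgebra k A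
  antipode_mem : ∀ a ∈ A, HopfAlgebra.antipode k a ∈ A

end

/-! The map `s ↦ i 1 ⊗ s` makes `E ⊗ S` an injective envelope of `S`; uniqueness of envelopes then
gives the isomorphism.

Injectivity (`IsInjective.tensor`): `E` is a retract of the cofree comodule `H ⊗ E`, so `E ⊗ S` is a
retract of `(H ⊗ E) ⊗ S`, which the antipode untwists into the cofree comodule `H ⊗ (E ⊗ S)`.

Essentiality (`IsInjectiveEnvelope.tensor_simple`): a nonzero subcomodule contains a simple one,
whose coefficients span a simple subcoalgebra, so it contains some `t ≠ 0` with coefficients in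
`H₀`. The coaction of the factor `E` alone is recovered from the diagonal one by multiplying by
antipodes of coefficients of `S`. As `H₀` is closed under products and the antipode, `t` lies in `E₀
⊗ S`, where `E₀` consists of the vectors of `E` with coefficients in `H₀`. Splitting the line of `1`
off `H₀` shows that `E₀` is the image of `k`, so `t` lies in the image of `S`. -/

noncomputable section

/-! ### Slice maps, and tensor subspaces detected by them. -/

section Slices

variable (k : Type u) [Field k]

/-- The slice map `C ⊗ M → M`, `c ⊗ m ↦ f(c) m`, of a functional `f` on `C`. -/
def leftSlice {C : Type v} [AddCommGroup C] [Module k C] (f : Module.Dual k C) (M : Type w)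
    [AddCommGroup M] [Module k M] : C ⊗[k] M →ₗ[k] M :=
  (TensorProduct.lid k M).toLinearMap ∘ₗ f.rTensor M

/-- The slice map `C ⊗ M → C`, `c ⊗ m ↦ g(m) c`, of a functional `g` on `M`. -/
def rightSlice (C : Type v) [AddCommGroup C] [Module k C] {M : Type w} [AddCommGroup M]
    [Module k M] (g : Module.Dual k M) : C ⊗[k] M →ₗ[k] C :=
  (TensorProduct.rid k C).toLinearMap ∘ₗ g.lTensor C

variable {k} {C : Type v} [AddCommGroup C] [Module k C] {M : Type w} [AddCommGroup M] [Module k M]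
  {N : Type w'} [AddCommGroup N] [Module k N]

@[simp]
theorem leftSlice_tmul (f : Module.Dual k C) (c : C) (m : M) :
    leftSlice k f M (c ⊗ₜ m) = f c • m := by
  simp [leftSlice]

@[simp]
theorem rightSlice_tmul (g : Module.Dual k M) (c : C) (m : M) :
    rightSlice k C g (c ⊗ₜ m) = g m • c := by
  simp [rightSlice]

theorem apply_rightSlice (f : Module.Dual k C) (g : Module.Dual k M) (x : C ⊗[k] M) :
    f (rightSlice k C g x) = g (leftSlice k f M x) := by
  induction x with
  | zero => simp
  | add x y hx hy => simp only [map_add, hx, hy]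
  | tmul c m => simp [mul_comm]

theorem leftSlice_lTensor (f : Module.Dual k C) (φ : M →ₗ[k] N) (x : C ⊗[k] M) :
    leftSlice k f N (φ.lTensor C x) = φ (leftSlice k f M x) := by
  induction x with
  | zero => simp
  | add x y hx hy => simp only [map_add, hx, hy]
  | tmul c m => simp

theorem rightSlice_lTensor (g : Module.Dual k N) (φ : M →ₗ[k] N) (x : C ⊗[k] M) :
    rightSlice k C g (φ.lTensor C x) = rightSlice k C (g ∘ₗ φ) x := by
  induction x with
  | zero => simp
  | add x y hx hy => simp only [map_add, hx, hy]
  | tmul c m => simp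

theorem rightSlice_rTensor (g : Module.Dual k N) (φ : C →ₗ[k] M) (x : C ⊗[k] N) :
    rightSlice k M g (φ.rTensor N x) = φ (rightSlice k C g x) := by
  induction x with
  | zero => simp
  | add x y hx hy => simp only [map_add, hx, hy]
  | tmul c m => simp

/-- The coordinates of a tensor with respect to a basis of `C` are its slices by the coordinate
functionals. -/
theorem eq_zero_of_forall_leftSlice {x : C ⊗[k] M}
    (h : ∀ f : Module.Dual k C, leftSlice k f M x = 0) : x = 0 := by
  classical
  apply (TensorProduct.equivFinsuppOfBasisLeft (N := M) (Module.Basis.ofVectorSpace k C)).injective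
  ext i
  rw [TensorProduct.equivFinsuppOfBasisLeft_apply, map_zero]
  exact h _

theorem eq_of_forall_leftSlice {x y : C ⊗[k] M}
    (h : ∀ f : Module.Dual k C, leftSlice k f M x = leftSlice k f M y) : x = y :=
  sub_eq_zero.mp (eq_zero_of_forall_leftSlice fun f => by rw [map_sub, h, sub_self])

theorem eq_zero_of_forall_rightSlice {x : C ⊗[k] M}
    (h : ∀ g : Module.Dual k M, rightSlice k C g x = 0) : x = 0 :=
  eq_zero_of_forall_leftSlice fun f => (Module.forall_dual_apply_eq_zero_iff k _).mp fun g => by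
    rw [← apply_rightSlice, h, map_zero]

theorem mem_range_lTensor_subtype_iff {W : Submodule k M} {x : C ⊗[k] M} :
    x ∈ LinearMap.range (W.subtype.lTensor C) ↔
      ∀ f : Module.Dual k C, leftSlice k f M x ∈ W := by
  constructor
  · rintro ⟨y, rfl⟩ f
    rw [leftSlice_lTensor]
    exact (leftSlice k f W y).2
  · intro h
    have hex : Function.Exact (W.subtype.lTensor C) (W.mkQ.lTensor C) :=
      lTensor_exact C (LinearMap.exact_subtype_mkQ W) W.mkQ_surjective
    refine (hex x).mp (eq_zero_of_forall_leftSlice fun f => ?_)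
    rw [leftSlice_lTensor]
    simpa using h f

theorem mem_range_rTensor_subtype_iff {D : Submodule k C} {x : C ⊗[k] M} :
    x ∈ LinearMap.range (D.subtype.rTensor M) ↔
      ∀ g : Module.Dual k M, rightSlice k C g x ∈ D := by
  constructor
  · rintro ⟨y, rfl⟩ f
    rw [rightSlice_rTensor]
    exact (rightSlice k D f y).2
  · intro h
    have hex : Function.Exact (D.subtype.rTensor M) (D.mkQ.rTensor M) :=
      rTensor_exact M (LinearMap.exact_subtype_mkQ D) D.mkQ_surjective
    refine (hex x).mp (eq_zero_of_forall_rightSlice fun f => ?_)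
    rw [rightSlice_rTensor]
    simpa using h f

/-- Over a field `(C ⊗ D) ∩ (D ⊗ C) = D ⊗ D`, and each of the two conditions is detected by slices.
-/
theorem mem_range_map_subtype_iff {D : Submodule k C} {x : C ⊗[k] C} :
    x ∈ LinearMap.range (TensorProduct.map D.subtype D.subtype) ↔
      (∀ f : Module.Dual k C, leftSlice k f C x ∈ D) ∧
        ∀ g : Module.Dual k C, rightSlice k C g x ∈ D := by
  constructor
  · rintro ⟨y, rfl⟩
    refine ⟨mem_range_lTensor_subtype_iff.mp ?_, mem_range_rTensor_subtype_iff.mp ?_⟩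
    · rw [← LinearMap.lTensor_comp_rTensor]
      exact ⟨_, rfl⟩
    · rw [← LinearMap.rTensor_comp_lTensor]
      exact ⟨_, rfl⟩
  · rintro ⟨h₁, h₂⟩
    obtain ⟨y, rfl⟩ := mem_range_rTensor_subtype_iff.mpr h₂
    have hy : y ∈ LinearMap.range (D.subtype.lTensor D) := by
      refine mem_range_lTensor_subtype_iff.mpr fun f => ?_
      obtain ⟨f', rfl⟩ := LinearMap.exists_extend f
      have h := h₁ f'
      convert h using 1
      simp only [leftSlice, LinearMap.comp_apply, LinearMap.rTensor_comp]
    obtain ⟨z, rfl⟩ := hy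
    refine ⟨z, ?_⟩
    rw [← LinearMap.rTensor_comp_lTensor]
    rfl

end Slices

namespace LeftComodule

/-! ### Comodules and coalgebras through functionals and matrix coefficients. -/

section Coefficients

variable (k : Type u) (C : Type v) [Field k] [AddCommGroup C] [Module k C] [Coalgebra k C]
  {M : Type w} [AddCommGroup M] [Module k M] [LeftComodule k C M]
  {N : Type w'} [AddCommGroup N] [Module k N] [LeftComodule k C N]

/-- The operator `m ↦ ∑ f(m₍₋₁₎) m₍₀₎` on a left comodule given by a functional `f`. -/
def act (f : Module.Dual k C) : M →ₗ[k] M := leftSlice k f M ∘ₗ coact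

/-- The matrix coefficients `m ↦ ∑ g(m₍₀₎) m₍₋₁₎` given by a functional `g`. -/
def coeff (g : Module.Dual k M) : M →ₗ[k] C := rightSlice k C g ∘ₗ coact

/-- The operator `c ↦ ∑ f(c₍₁₎) c₍₂₎` on a coalgebra. -/
def leftHit (f : Module.Dual k C) : C →ₗ[k] C := leftSlice k f C ∘ₗ Coalgebra.comul

/-- The operator `c ↦ ∑ f(c₍₂₎) c₍₁₎` on a coalgebra. -/
def rightHit (f : Module.Dual k C) : C →ₗ[k] C := rightSlice k C f ∘ₗ Coalgebra.comul

variable {k C}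

theorem apply_coeff (f : Module.Dual k C) (g : Module.Dual k M) (m : M) :
    f (coeff k C g m) = g (act k C f m) :=
  apply_rightSlice f g _

theorem apply_rightHit (f g : Module.Dual k C) (c : C) :
    f (rightHit k C g c) = g (leftHit k C f c) :=
  apply_rightSlice f g _

theorem act_counit (m : M) : act k C Coalgebra.counit m = m :=
  LinearMap.congr_fun (counit_coact (k := k) (C := C) (M := M)) m

theorem isSubcomodule_iff {W : Submodule k M} :
    IsSubcomodule k C W ↔ ∀ m ∈ W, ∀ f : Module.Dual k C, act k C f m ∈ W :=
  forall₂_congr fun _ _ => mem_range_lTensor_subtype_iff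

theorem isSubcoalgebra_iff {D : Submodule k C} :
    IsSubcoalgebra k D ↔ ∀ d ∈ D, (∀ f : Module.Dual k C, leftHit k C f d ∈ D) ∧
      ∀ g : Module.Dual k C, rightHit k C g d ∈ D :=
  forall₂_congr fun _ _ => mem_range_map_subtype_iff

theorem isHom_iff {φ : M →ₗ[k] N} :
    IsHom k C φ ↔ ∀ (f : Module.Dual k C) (m : M), act k C f (φ m) = φ (act k C f m) := by
  constructor
  · intro h f m
    have := LinearMap.congr_fun h m
    simp only [LinearMap.comp_apply] at this
    simp only [act, LinearMap.comp_apply, this, leftSlice_lTensor]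
  · intro h
    refine LinearMap.ext fun m => eq_of_forall_leftSlice fun f => ?_
    rw [LinearMap.comp_apply, LinearMap.comp_apply, leftSlice_lTensor]
    exact h f m

/-- Coassociativity says exactly that `coeff k C g` is a comodule map from `M` to the regular
comodule `C`. -/
theorem comul_coeff (g : Module.Dual k M) (m : M) :
    Coalgebra.comul (R := k) (coeff k C g m) = (coeff k C g).lTensor C (coact m) := by
  have hm := LinearMap.congr_fun (coassoc (k := k) (C := C) (M := M)) m
  simp only [LinearMap.comp_apply, LinearEquiv.coe_coe] at hm
  rw [coeff, LinearMap.lTensor_comp, LinearMap.comp_apply, LinearMap.comp_apply, ← hm]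
  generalize coact (k := k) (C := C) m = x
  induction x with
  | zero => simp
  | add x y hx hy => simp only [map_add, hx, hy]
  | tmul c m =>
    simp only [rightSlice_tmul, map_smul, LinearMap.rTensor_tmul]
    generalize Coalgebra.comul (R := k) c = p
    induction p with
    | zero => simp
    | add x y hx hy => simp only [map_add, smul_add, TensorProduct.add_tmul, hx, hy]
    | tmul a b => simp

theorem leftHit_coeff (f : Module.Dual k C) (g : Module.Dual k M) (m : M) :
    leftHit k C f (coeff k C g m) = coeff k C g (act k C f m) := by
  rw [leftHit, LinearMap.comp_apply, comul_coeff, leftSlice_lTensor]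
  rfl

theorem rightHit_coeff (h : Module.Dual k C) (g : Module.Dual k M) (m : M) :
    rightHit k C h (coeff k C g m) = coeff k C (h ∘ₗ coeff k C g) m := by
  rw [rightHit, LinearMap.comp_apply, comul_coeff, rightSlice_lTensor]
  rfl

theorem isSubcomodule_ker {φ : M →ₗ[k] N} (h : IsHom k C φ) :
    IsSubcomodule k C (LinearMap.ker φ) :=
  isSubcomodule_iff.mpr fun m hm f => by
    rw [LinearMap.mem_ker] at hm ⊢
    rw [← isHom_iff.mp h, hm, map_zero]

/-- The vectors of a left comodule whose matrix coefficients all lie in `D`. -/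
def coeffSubmodule (D : Submodule k C) (M : Type w) [AddCommGroup M] [Module k M]
    [LeftComodule k C M] : Submodule k M :=
  ⨅ g : Module.Dual k M, D.comap (coeff k C g)

theorem mem_coeffSubmodule {D : Submodule k C} {m : M} :
    m ∈ coeffSubmodule D M ↔ ∀ g : Module.Dual k M, coeff k C g m ∈ D := by
  simp [coeffSubmodule]

theorem mem_coeffSubmodule_iff_coact {D : Submodule k C} {m : M} :
    m ∈ coeffSubmodule D M ↔ coact m ∈ LinearMap.range (D.subtype.rTensor M) :=
  mem_coeffSubmodule.trans mem_range_rTensor_subtype_iff.symm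

theorem isSubcomodule_coeffSubmodule {D : Submodule k C} (hD : IsSubcoalgebra k D) :
    IsSubcomodule k C (coeffSubmodule D M) :=
  isSubcomodule_iff.mpr fun m hm f => mem_coeffSubmodule.mpr fun g => by
    rw [← leftHit_coeff]
    exact (isSubcoalgebra_iff.mp hD _ (mem_coeffSubmodule.mp hm g)).1 f

end Coefficients
end LeftComodule

namespace LeftComodule

/-! ### Simple subcomodules and the coradical. -/

section Socle

variable {k : Type u} {C : Type v} [Field k] [AddCommGroup C] [Module k C] [Coalgebra k C]
  {M : Type w} [AddCommGroup M] [Module k M] [LeftComodule k C M]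

theorem eq_zero_of_forall_coeff {m : M}
    (h : ∀ g : Module.Dual k M, coeff k C g m = (0 : C)) : m = 0 := by
  refine (Module.forall_dual_apply_eq_zero_iff k m).mp fun g => ?_
  rw [← act_counit (k := k) (C := C) m, ← apply_coeff, h, map_zero]

theorem leftHit_mem_coeff {W : Submodule k M} (hW : IsSubcomodule k C W)
    (F : Finset (Module.Dual k M)) (f : Module.Dual k C) {c : C}
    (hc : c ∈ ⨆ g ∈ F, W.map (coeff k C g)) :
    leftHit k C f c ∈ ⨆ g ∈ F, W.map (coeff k C g) := by
  have : (⨆ g ∈ F, W.map (coeff k C g)) ≤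
      (⨆ g ∈ F, W.map (coeff k C g)).comap (leftHit k C f) := by
    refine iSup₂_le fun g hg => ?_
    rintro _ ⟨m, hm, rfl⟩
    rw [Submodule.mem_comap, leftHit_coeff]
    exact le_iSup₂_of_le (f := fun g (_ : g ∈ F) => W.map (coeff k C g)) g hg le_rfl
      (Submodule.mem_map_of_mem (isSubcomodule_iff.mp hW m hm f))
  exact this hc

/-- The coefficient space of a subcomodule. -/
def coeffSpace (C : Type v) [AddCommGroup C] [Module k C] [Coalgebra k C] [LeftComodule k C M]
    (W : Submodule k M) : Submodule k C :=
  ⨆ g : Module.Dual k M, W.map (coeff k C g)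

theorem coeff_mem_coeffSpace {W : Submodule k M} (g : Module.Dual k M) {m : M} (hm : m ∈ W) :
    coeff k C g m ∈ coeffSpace C W :=
  Submodule.mem_iSup_of_mem g (Submodule.mem_map_of_mem hm)

theorem isSubcoalgebra_coeffSpace {W : Submodule k M} (hW : IsSubcomodule k C W) :
    IsSubcoalgebra k (coeffSpace C W) := by
  refine isSubcoalgebra_iff.mpr fun d hd => ⟨fun f => ?_, fun f => ?_⟩
  · have : coeffSpace C W ≤ (coeffSpace C W).comap (leftHit k C f) := by
      refine iSup_le fun g => ?_
      rintro _ ⟨m, hm, rfl⟩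
      rw [Submodule.mem_comap, leftHit_coeff]
      exact coeff_mem_coeffSpace _ (isSubcomodule_iff.mp hW m hm f)
    exact this hd
  · have : coeffSpace C W ≤ (coeffSpace C W).comap (rightHit k C f) := by
      refine iSup_le fun g => ?_
      rintro _ ⟨m, hm, rfl⟩
      rw [Submodule.mem_comap, rightHit_coeff]
      exact coeff_mem_coeffSpace _ hm
    exact this hd

theorem coeff_eq_of_eqOn {W : Submodule k M} (hW : IsSubcomodule k C W)
    {g g' : Module.Dual k M} (h : ∀ m ∈ W, g m = g' m) {m : M} (hm : m ∈ W) :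
    coeff k C g m = coeff k C g' m := by
  refine sub_eq_zero.mp ((Module.forall_dual_apply_eq_zero_iff k _).mp fun f => ?_)
  rw [map_sub, apply_coeff, apply_coeff, h _ (isSubcomodule_iff.mp hW m hm f), sub_self]

theorem rightHit_eq_zero {P : Submodule k C}
    (hP : ∀ c ∈ P, ∀ f : Module.Dual k C, leftHit k C f c ∈ P) {h : Module.Dual k C}
    (hh : ∀ c ∈ P, h c = 0) {c : C} (hc : c ∈ P) : rightHit k C h c = 0 := by
  refine (Module.forall_dual_apply_eq_zero_iff k _).mp fun f => ?_
  rw [apply_rightHit, hh _ (hP c hc f)]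

theorem isSubcomodule_inf_comap_coeff {W : Submodule k M} (hW : IsSubcomodule k C W)
    {P : Submodule k C} (hP : ∀ c ∈ P, ∀ f : Module.Dual k C, leftHit k C f c ∈ P)
    (g : Module.Dual k M) : IsSubcomodule k C (W ⊓ P.comap (coeff k C g)) :=
  isSubcomodule_iff.mpr fun m hm f => ⟨isSubcomodule_iff.mp hW m hm.1 f, by
    have := hP _ hm.2 f
    rwa [leftHit_coeff] at this⟩

/-- If a nonzero element of a subcoalgebra `D` is a sum of coefficients of a simple
subcomodule `W`, then all coefficients of `W` lie in `D`. -/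
theorem coeffSpace_le_of_inf_ne_bot {W : Submodule k M} (hW : IsSubcomodule k C W)
    (hmin : ∀ W' : Submodule k M, IsSubcomodule k C W' → W' ≤ W → W' = ⊥ ∨ W' = W)
    {D : Submodule k C} (hD : IsSubcoalgebra k D) (F : Finset (Module.Dual k M))
    (hF : (⨆ g ∈ F, W.map (coeff k C g)) ⊓ D ≠ ⊥) : coeffSpace C W ≤ D := by
  classical
  induction F using Finset.induction_on with
  | empty => simp at hF
  | insert g F hg ih =>
    by_cases hFD : (⨆ g ∈ F, W.map (coeff k C g)) ⊓ D = ⊥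
    swap
    · exact ih hFD
    have hPs := fun c (hc : c ∈ ⨆ g ∈ F, W.map (coeff k C g)) f => leftHit_mem_coeff hW F f hc
    rw [Finset.iSup_insert] at hF
    generalize (⨆ g ∈ F, W.map (coeff k C g)) = P at hF hFD hPs
    obtain ⟨x, hx, hx0⟩ := Submodule.exists_mem_ne_zero_of_ne_bot hF
    obtain ⟨hxP, hxD⟩ := hx
    obtain ⟨_, ⟨t, ht, rfl⟩, q, hq, rfl⟩ := Submodule.mem_sup.mp hxP
    -- Otherwise `x` would be a nonzero element of `P ⊓ D`.
    have htP : coeff k C g t ∉ P := fun h => hx0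
      ((Submodule.eq_bot_iff _).mp hFD _ ⟨P.add_mem h hq, hxD⟩)
    have hsup : ∀ c ∈ P ⊔ D, ∀ f : Module.Dual k C, leftHit k C f c ∈ P ⊔ D := by
      intro c hc f
      obtain ⟨p, hp, d, hd, rfl⟩ := Submodule.mem_sup.mp hc
      rw [map_add]
      exact Submodule.add_mem_sup (hPs p hp f) ((isSubcoalgebra_iff.mp hD d hd).1 f)
    -- Simplicity of `W` is used twice: `t` witnesses that `coeff k C g` maps all of `W` into `P ⊔
    -- D`, and also that it is injective on `W` modulo `P`.
    have hall : W ⊓ (P ⊔ D).comap (coeff k C g) = W := by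
      refine (hmin _ (isSubcomodule_inf_comap_coeff hW hsup g) inf_le_left).resolve_left fun h => ?_
      have ht0 := (Submodule.eq_bot_iff _).mp h t ⟨ht, by
        have := Submodule.add_mem_sup (P.neg_mem hq) hxD
        simpa using this⟩
      exact htP (by rw [ht0, map_zero]; exact P.zero_mem)
    have hker : W ⊓ P.comap (coeff k C g) = ⊥ := by
      refine (hmin _ (isSubcomodule_inf_comap_coeff hW hPs g) inf_le_left).resolve_right fun h => ?_
      have : t ∈ W ⊓ P.comap (coeff k C g) := h.symm.le ht
      exact htP this.2
    obtain ⟨s, hs⟩ := LinearMap.exists_leftInverse_of_injective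
      (P.mkQ ∘ₗ coeff k C g ∘ₗ W.subtype) (LinearMap.ker_eq_bot'.mpr fun m hm =>
        Subtype.ext ((Submodule.eq_bot_iff _).mp hker m ⟨m.2, by simpa using hm⟩))
    refine iSup_le fun g' => ?_
    rintro _ ⟨m, hm, rfl⟩
    -- Through the left inverse `s`, any `g'` agrees on `W` with `h ∘ₗ coeff k C g` for an `h` that
    -- vanishes on `P`. Thus the coefficient for `g'` is `rightHit k C h` of the one for `g`; this
    -- kills the `P` part and keeps the `D` part in `D`.
    let h : Module.Dual k C := g' ∘ₗ W.subtype ∘ₗ s ∘ₗ P.mkQ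
    have h1 : ∀ m ∈ W, g' m = (h ∘ₗ coeff k C g) m := fun m hm => by
      have := LinearMap.congr_fun hs ⟨m, hm⟩
      simp only [LinearMap.comp_apply, LinearMap.id_apply, Submodule.subtype_apply] at this
      simp only [h, LinearMap.comp_apply, this, Submodule.subtype_apply]
    rw [coeff_eq_of_eqOn hW h1 hm, ← rightHit_coeff]
    have hmPD : m ∈ W ⊓ (P ⊔ D).comap (coeff k C g) := hall.symm ▸ hm
    obtain ⟨p, hp, d, hd, hpd⟩ := Submodule.mem_sup.mp hmPD.2
    rw [← hpd, map_add, rightHit_eq_zero hPs (fun c hc => ?_) hp, zero_add]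
    · exact (isSubcoalgebra_iff.mp hD d hd).2 h
    · simp [h, (Submodule.Quotient.mk_eq_zero P).mpr hc]

theorem isSimpleSubcoalgebra_coeffSpace {W : Submodule k M} (hW : IsSubcomodule k C W)
    (hW0 : W ≠ ⊥)
    (hmin : ∀ W' : Submodule k M, IsSubcomodule k C W' → W' ≤ W → W' = ⊥ ∨ W' = W) :
    IsSimpleSubcoalgebra k (coeffSpace C W) := by
  refine ⟨isSubcoalgebra_coeffSpace hW, fun h => ?_, fun D hD hDW => ?_⟩
  · obtain ⟨m, hm, hm0⟩ := Submodule.exists_mem_ne_zero_of_ne_bot hW0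
    exact hm0 (eq_zero_of_forall_coeff fun g =>
      (Submodule.eq_bot_iff _).mp h _ (coeff_mem_coeffSpace g hm))
  · refine or_iff_not_imp_left.mpr fun hD0 => le_antisymm hDW ?_
    obtain ⟨d, hd, hd0⟩ := Submodule.exists_mem_ne_zero_of_ne_bot hD0
    obtain ⟨F, hF⟩ := Submodule.mem_iSup_iff_exists_finset.mp (hDW hd)
    exact coeffSpace_le_of_inf_ne_bot hW hmin hD F fun h =>
      hd0 ((Submodule.eq_bot_iff _).mp h d ⟨hF, hd⟩)

variable (k C) in
/-- The subcomodule generated by an element. -/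
def generated (m : M) : Submodule k M where
  carrier := {x | ∃ f : Module.Dual k C, act k C f m = x}
  zero_mem' := ⟨0, by simp [act, leftSlice]⟩
  add_mem' := by
    rintro _ _ ⟨f, rfl⟩ ⟨f', rfl⟩
    exact ⟨f + f', by simp [act, leftSlice, LinearMap.rTensor_add]⟩
  smul_mem' := by
    rintro a _ ⟨f, rfl⟩
    exact ⟨a • f, by simp [act, leftSlice, LinearMap.rTensor_smul]⟩

theorem isSubcomodule_generated (m : M) : IsSubcomodule k C (generated k C m) := by
  refine isSubcomodule_iff.mpr ?_
  rintro _ ⟨f, rfl⟩ f'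
  -- Acting by `f` and then by `f'` is acting by their convolution product, which is this
  -- functional.
  refine ⟨f' ∘ₗ leftHit k C f, sub_eq_zero.mp
    ((Module.forall_dual_apply_eq_zero_iff k _).mp fun g => ?_)⟩
  rw [map_sub, ← apply_coeff, ← apply_coeff, ← leftHit_coeff]
  simp

/-- The single tensor `coact m` lies in `C ⊗ W` for some finite-dimensional `W`, which then contains
all its slices. -/
theorem finite_generated (m : M) : Module.Finite k (generated k C m) := by
  obtain ⟨W, hW, h⟩ := TensorProduct.exists_finite_submodule_right_of_setFinite
    {coact (k := k) (C := C) m} (Set.finite_singleton _)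
  refine Submodule.finiteDimensional_of_le (S₂ := W) ?_
  rintro _ ⟨f, rfl⟩
  exact mem_range_lTensor_subtype_iff.mp (Set.singleton_subset_iff.mp h) f

/-- Every nonzero subcomodule contains a simple one. -/
theorem exists_simple_subcomodule {N : Submodule k M} (hN : IsSubcomodule k C N) (hN0 : N ≠ ⊥) :
    ∃ W ≤ N, IsSubcomodule k C W ∧ W ≠ ⊥ ∧
      ∀ W' : Submodule k M, IsSubcomodule k C W' → W' ≤ W → W' = ⊥ ∨ W' = W := by
  -- A nonzero finite-dimensional subcomodule of least dimension is simple.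
  let p : ℕ → Prop := fun n => ∃ W ≤ N, IsSubcomodule k C W ∧ W ≠ ⊥ ∧
    Module.Finite k W ∧ Module.finrank k W = n
  have hp : ∃ n, p n := by
    obtain ⟨m, hm, hm0⟩ := Submodule.exists_mem_ne_zero_of_ne_bot hN0
    refine ⟨_, generated k C m, ?_, isSubcomodule_generated m, fun h => hm0 ?_,
      finite_generated m, rfl⟩
    · rintro _ ⟨f, rfl⟩
      exact isSubcomodule_iff.mp hN m hm f
    · exact (Submodule.eq_bot_iff _).mp h m ⟨Coalgebra.counit, act_counit m⟩
  classical
  obtain ⟨W, hWN, hW, hW0, hfin, hrank⟩ := Nat.find_spec hp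
  refine ⟨W, hWN, hW, hW0, fun W' hW' hle => or_iff_not_imp_left.mpr fun h0 => ?_⟩
  refine Submodule.eq_of_le_of_finrank_le hle ?_
  rw [hrank]
  exact Nat.find_min' hp ⟨W', hle.trans hWN, hW', h0, Submodule.finiteDimensional_of_le hle, rfl⟩

theorem exists_ne_zero_mem_coeffSubmodule_coradical {N : Submodule k M}
    (hN : IsSubcomodule k C N) (hN0 : N ≠ ⊥) :
    ∃ m ∈ N, m ≠ 0 ∧ m ∈ coeffSubmodule (coradical k C) M := by
  obtain ⟨W, hWN, hW, hW0, hmin⟩ := exists_simple_subcomodule hN hN0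
  obtain ⟨m, hm, hm0⟩ := Submodule.exists_mem_ne_zero_of_ne_bot hW0
  have hle : coeffSpace C W ≤ coradical k C :=
    le_sSup (isSimpleSubcoalgebra_coeffSpace hW hW0 hmin)
  exact ⟨m, hWN hm, hm0, mem_coeffSubmodule.mpr fun g => hle (coeff_mem_coeffSpace g hm)⟩

theorem IsSimple.coeffSubmodule_coradical_eq_top (hM : IsSimple k C M)
    (hC : IsSubcoalgebra k (coradical k C)) : coeffSubmodule (coradical k C) M = ⊤ := by
  have := hM.1
  refine (hM.2 _ (isSubcomodule_coeffSubmodule hC)).resolve_left fun h => ?_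
  obtain ⟨m, -, hm0, hm⟩ := exists_ne_zero_mem_coeffSubmodule_coradical (k := k) (C := C)
    (N := (⊤ : Submodule k M)) (isSubcomodule_iff.mpr fun _ _ _ => Submodule.mem_top) top_ne_bot
  exact hm0 ((Submodule.eq_bot_iff _).mp h m hm)

end Socle

/-! ### Uniqueness of injective envelopes. -/

section Envelope

variable {k : Type u} {C : Type v} [Field k] [AddCommGroup C] [Module k C] [Coalgebra k C]

theorem IsHom.injective_of_comp_injective {M : Type w} {E : Type w'} {N : Type*}
    [AddCommGroup M] [Module k M]
    [AddCommGroup E] [Module k E] [LeftComodule k C E]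
    [AddCommGroup N] [Module k N] [LeftComodule k C N] {i : M →ₗ[k] E} {φ : E →ₗ[k] N}
    (hi : ∀ N : Submodule k E, IsSubcomodule k C N → N ≠ ⊥ → N ⊓ LinearMap.range i ≠ ⊥)
    (hφ : IsHom k C φ) (h : Function.Injective (φ ∘ₗ i)) : Function.Injective φ := by
  rw [← LinearMap.ker_eq_bot]
  by_contra h0
  refine hi _ (isSubcomodule_ker hφ) h0 ((Submodule.eq_bot_iff _).mpr ?_)
  rintro _ ⟨hx, m, rfl⟩
  rw [h ((show (φ ∘ₗ i) m = (φ ∘ₗ i) 0 by simpa using hx)), map_zero]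

/-- Extending `i'` along `i` gives `φ`, injective by essentiality of `i`. Injectivity of `E` gives a
retraction `r` of `φ`, itself injective by essentiality of `i'`; hence `φ` is onto. -/
theorem IsInjectiveEnvelope.exists_equiv {M E E' : Type w} [AddCommGroup M] [Module k M]
    [LeftComodule k C M] [AddCommGroup E] [Module k E] [LeftComodule k C E]
    [AddCommGroup E'] [Module k E'] [LeftComodule k C E'] {i : M →ₗ[k] E} {i' : M →ₗ[k] E'}
    (hi : IsInjectiveEnvelope k C i) (hi' : IsInjectiveEnvelope k C i') :
    ∃ e : E ≃ₗ[k] E', IsHom k C e.toLinearMap := by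
  obtain ⟨φ, hφ, hφi⟩ := hi'.isInjective M E i i' hi.isHom hi.injective hi'.isHom
  have hφinj : Function.Injective φ :=
    hφ.injective_of_comp_injective hi.essential (hφi ▸ hi'.injective)
  obtain ⟨r, hr, hrφ⟩ := hi.isInjective E E' φ LinearMap.id hφ hφinj
    (isHom_iff.mpr fun _ _ => rfl)
  have hri : r ∘ₗ i' = i := by rw [← hφi, ← LinearMap.comp_assoc, hrφ, LinearMap.id_comp]
  have hrinj : Function.Injective r :=
    hr.injective_of_comp_injective hi'.essential (hri ▸ hi.injective)
  have hrφ' := LinearMap.congr_fun hrφ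
  exact ⟨LinearEquiv.ofBijective φ ⟨hφinj, fun x => ⟨r x, hrinj (hrφ' (r x))⟩⟩, hφ⟩

end Envelope

end LeftComodule

/-! ### Splitting a grouplike element off the coradical. -/

section Decomposition

theorem exists_dual_apply_eq_one {k : Type*} [Field k] {V : Type*} [AddCommGroup V] [Module k V]
    {D : Submodule k V} {x : V} (hx : x ∉ D) :
    ∃ f : Module.Dual k V, f x = 1 ∧ ∀ d ∈ D, f d = 0 := by
  obtain ⟨f, hfx, hf⟩ := Submodule.exists_dual_map_eq_bot_of_notMem hx inferInstance
  refine ⟨(f x)⁻¹ • f, inv_mul_cancel₀ hfx, fun d hd => ?_⟩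
  have h : f d ∈ D.map f := Submodule.mem_map_of_mem hd
  rw [hf, Submodule.mem_bot] at h
  simp [h]

variable {k : Type u} {C : Type v} [Field k] [AddCommGroup C] [Module k C] [Coalgebra k C]

theorem isSubcoalgebra_sup {D D' : Submodule k C} (h : IsSubcoalgebra k D)
    (h' : IsSubcoalgebra k D') : IsSubcoalgebra k (D ⊔ D') := by
  rw [LeftComodule.isSubcoalgebra_iff] at *
  intro d hd
  obtain ⟨a, ha, b, hb, rfl⟩ := Submodule.mem_sup.mp hd
  simp only [map_add]
  exact ⟨fun f => Submodule.add_mem_sup ((h a ha).1 f) ((h' b hb).1 f),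
    fun f => Submodule.add_mem_sup ((h a ha).2 f) ((h' b hb).2 f)⟩

theorem isSubcoalgebra_finset_sup (F : Finset (Submodule k C))
    (hF : ∀ D ∈ F, IsSubcoalgebra k D) : IsSubcoalgebra k (⨆ D ∈ F, D) := by
  classical
  induction F using Finset.induction_on with
  | empty =>
    simp only [Finset.notMem_empty, iSup_false, iSup_bot]
    rintro _ rfl
    simp
  | insert D F _ ih =>
    rw [Finset.iSup_insert]
    exact isSubcoalgebra_sup (hF D (Finset.mem_insert_self D F))
      (ih fun D' h => hF D' (Finset.mem_insert_of_mem h))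

theorem isSubcoalgebra_sSup {𝒟 : Set (Submodule k C)} (h𝒟 : ∀ D ∈ 𝒟, IsSubcoalgebra k D) :
    IsSubcoalgebra k (sSup 𝒟) := by
  rw [LeftComodule.isSubcoalgebra_iff]
  intro d hd
  obtain ⟨F, hF, hdF⟩ := Submodule.mem_sSup_iff_exists_finset.mp hd
  have hle : (⨆ D ∈ F, D) ≤ sSup 𝒟 := iSup₂_le fun D hD => le_sSup (hF hD)
  have h := LeftComodule.isSubcoalgebra_iff.mp
    (isSubcoalgebra_finset_sup F fun D hD => h𝒟 D (hF hD)) d hdF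
  exact ⟨fun f => hle (h.1 f), fun f => hle (h.2 f)⟩

namespace LeftComodule

theorem leftHit_eq_zero {D : Submodule k C} (hD : IsSubcoalgebra k D) {f : Module.Dual k C}
    (hf : ∀ d ∈ D, f d = 0) {d : C} (hd : d ∈ D) : leftHit k C f d = 0 :=
  (Module.forall_dual_apply_eq_zero_iff k _).mp fun g => by
    rw [← apply_rightHit]
    exact hf _ ((isSubcoalgebra_iff.mp hD d hd).2 g)

end LeftComodule

open LeftComodule

/-- A grouplike element contained in a sum of subcoalgebras is contained in one of them. -/
theorem exists_mem_of_mem_sSup {x : C} (hx : Coalgebra.comul (R := k) x = x ⊗ₜ x) (hx0 : x ≠ 0)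
    {𝒟 : Set (Submodule k C)} (h𝒟 : ∀ D ∈ 𝒟, IsSubcoalgebra k D) (h : x ∈ sSup 𝒟) :
    ∃ D ∈ 𝒟, x ∈ D := by
  obtain ⟨F, hF, hxF⟩ := Submodule.mem_sSup_iff_exists_finset.mp h
  classical
  induction F using Finset.induction_on with
  | empty => simp [hx0] at hxF
  | insert D F hD ih =>
    rw [Finset.coe_insert, Set.insert_subset_iff] at hF
    by_cases hxD : x ∈ D
    · exact ⟨D, hF.1, hxD⟩
    · refine ih hF.2 ?_
      -- The operator `leftHit k C f` fixes `x`, kills `D` and preserves the other subcoalgebras, so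
      -- `x` already lies in their sum.
      obtain ⟨f, hfx, hf⟩ := exists_dual_apply_eq_one hxD
      have h1 : leftHit k C f x = x := by simp [leftHit, hx, hfx]
      rw [Finset.iSup_insert] at hxF
      obtain ⟨a, ha, b, hb, hab⟩ := Submodule.mem_sup.mp hxF
      rw [← h1, ← hab, map_add, leftHit_eq_zero (h𝒟 D hF.1) hf ha, zero_add]
      exact (isSubcoalgebra_iff.mp
        (isSubcoalgebra_finset_sup F fun D hD => h𝒟 D (hF.2 hD)) b hb).1 f

theorem isSubcoalgebra_span_singleton {x : C} (hx : Coalgebra.comul (R := k) x = x ⊗ₜ x) :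
    IsSubcoalgebra k (Submodule.span k {x}) := by
  rw [isSubcoalgebra_iff]
  intro d hd
  obtain ⟨a, rfl⟩ := Submodule.mem_span_singleton.mp hd
  refine ⟨fun f => ?_, fun f => ?_⟩ <;>
  · simp only [leftHit, rightHit, map_smul, LinearMap.comp_apply, hx, leftSlice_tmul,
      rightSlice_tmul]
    exact Submodule.smul_mem _ _ (Submodule.smul_mem _ _ (Submodule.mem_span_singleton_self x))

/-- The line spanned by a grouplike element has a complementary subcoalgebra in the coradical. -/
theorem exists_isSubcoalgebra_coradical_le {x : C}
    (hx : Coalgebra.comul (R := k) x = x ⊗ₜ x) (hx0 : x ≠ 0) :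
    ∃ D : Submodule k C, IsSubcoalgebra k D ∧ x ∉ D ∧
      coradical k C ≤ Submodule.span k {x} ⊔ D := by
  have hsub : ∀ D ∈ {D : Submodule k C | IsSimpleSubcoalgebra k D ∧ x ∉ D},
    IsSubcoalgebra k D := fun D hD => hD.1.1
  refine ⟨sSup {D | IsSimpleSubcoalgebra k D ∧ x ∉ D}, isSubcoalgebra_sSup hsub, fun h => ?_,
    sSup_le fun D hD => ?_⟩
  · obtain ⟨D, hD, hxD⟩ := exists_mem_of_mem_sSup hx hx0 hsub h
    exact hD.2 hxD
  -- A simple subcoalgebra containing `x` is the line of `x`; all others are summands of the chosen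
  -- complement.
  · by_cases hxD : x ∈ D
    · have hle : Submodule.span k {x} ≤ D := (Submodule.span_singleton_le_iff_mem x D).mpr hxD
      have := (hD.2.2 _ (isSubcoalgebra_span_singleton hx) hle).resolve_left (by simpa using hx0)
      exact this ▸ le_sup_left
    · exact le_sup_of_le_right (le_sSup ⟨hD, hxD⟩)

end Decomposition

namespace LeftComodule

/-! ### Vectors of `E` with coefficients in the coradical. -/

section Coinvariants

variable {k : Type u} {H : Type v} [Field k] [Ring H] [Bialgebra k H]
  {E : Type w} [AddCommGroup E] [Module k E] [LeftComodule k H E]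

theorem coact_of_isHom_trivial {i : k →ₗ[k] E} (hi : IsHom k H i) :
    coact (k := k) (C := H) (i 1) = 1 ⊗ₜ i 1 := by
  have h := LinearMap.congr_fun hi 1
  simp only [LinearMap.comp_apply] at h
  rw [h]
  exact LinearMap.lTensor_tmul H i 1 1

theorem one_ne_zero_of_bialgebra (k : Type u) (H : Type v) [Field k] [Ring H] [Bialgebra k H] :
    (1 : H) ≠ 0 := fun h => by
  have h1 : Coalgebra.counit (R := k) (1 : H) = 1 := Bialgebra.counit_one
  rw [h, map_zero] at h1
  exact zero_ne_one h1

/-- In an essential extension of the trivial comodule, the vectors with coefficients in the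
coradical form the trivial comodule. -/
theorem coeffSubmodule_coradical_le_range {i : k →ₗ[k] E} (hi : IsHom k H i)
    (hinj : Function.Injective i)
    (hess : ∀ N : Submodule k E, IsSubcomodule k H N → N ≠ ⊥ → N ⊓ LinearMap.range i ≠ ⊥) :
    coeffSubmodule (coradical k H) E ≤ LinearMap.range i := by
  have hi1 : i 1 ≠ 0 := fun h => one_ne_zero (hinj (h.trans (map_zero i).symm))
  have hcoeff : ∀ g : Module.Dual k E, coeff k H g (i 1) = g (i 1) • (1 : H) := fun g => by
    rw [coeff, LinearMap.comp_apply, coact_of_isHom_trivial hi, rightSlice_tmul]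
  obtain ⟨D, hD, h1D, hle⟩ := exists_isSubcoalgebra_coradical_le (k := k) (C := H) (x := 1)
    (by rw [Bialgebra.comul_one]; rfl) (one_ne_zero_of_bialgebra k H)
  -- If nonzero, this subcomodule would contain `i 1` by essentiality; the coefficients of `i 1` are
  -- multiples of `1`, which is not in `D`.
  have hED : coeffSubmodule D E = ⊥ := by
    by_contra h0
    obtain ⟨_, ⟨hxD, c, rfl⟩, hx0⟩ := Submodule.exists_mem_ne_zero_of_ne_bot
      (hess _ (isSubcomodule_coeffSubmodule hD) h0)
    have hc : c ≠ 0 := fun h => hx0 (by rw [h, map_zero])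
    have hx1 : i 1 ∈ coeffSubmodule D E := by
      have := Submodule.smul_mem _ c⁻¹ hxD
      rwa [← map_smul, smul_eq_mul, inv_mul_cancel₀ hc] at this
    obtain ⟨g, hg⟩ : ∃ g : Module.Dual k E, g (i 1) ≠ 0 := by
      by_contra! h
      exact hi1 ((Module.forall_dual_apply_eq_zero_iff k _).mp h)
    have h2 := mem_coeffSubmodule.mp hx1 g
    rw [hcoeff] at h2
    exact h1D ((Submodule.smul_mem_iff D hg).mp h2)
  obtain ⟨f, hf1, hfD⟩ := exists_dual_apply_eq_one h1D
  intro e he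
  have hdec : ∀ g : Module.Dual k E, ∃ a : k, ∃ d ∈ D, a • (1 : H) + d = coeff k H g e ∧
      coeff k H g (act k H f e) = a • 1 := fun g => by
    obtain ⟨_, hb, d, hd, had⟩ := Submodule.mem_sup.mp (hle (mem_coeffSubmodule.mp he g))
    obtain ⟨a, rfl⟩ := Submodule.mem_span_singleton.mp hb
    refine ⟨a, d, hd, had, ?_⟩
    rw [← leftHit_coeff, ← had, map_add, leftHit_eq_zero hD hfD hd, add_zero, map_smul]
    simp [leftHit, Algebra.TensorProduct.one_def, hf1]
  -- Acting by `f` projects coefficients onto the line of `1`, so the difference has coefficients in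
  -- `D` and vanishes. Hence `e` is coinvariant, and essentiality applied to its line puts `e` in
  -- the range of `i`.
  have hfe : e = act k H f e := by
    have : e - act k H f e ∈ coeffSubmodule D E := mem_coeffSubmodule.mpr fun g => by
      obtain ⟨a, d, hd, h1, h2⟩ := hdec g
      rw [map_sub, h2, ← h1, add_sub_cancel_left]
      exact hd
    rw [hED, Submodule.mem_bot] at this
    exact sub_eq_zero.mp this
  have hact : ∀ f' : Module.Dual k H, act k H f' e = f' 1 • e := fun f' => by
    refine sub_eq_zero.mp ((Module.forall_dual_apply_eq_zero_iff k _).mp fun g => ?_)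
    obtain ⟨a, d, hd, h1, h2⟩ := hdec g
    rw [← hfe] at h2
    have h3 : g e = a := by
      rw [← act_counit (k := k) (C := H) e, ← apply_coeff, h2, map_smul, Bialgebra.counit_one,
        smul_eq_mul, mul_one]
    rw [map_sub, ← apply_coeff, h2, map_smul, map_smul, h3, smul_eq_mul, smul_eq_mul, mul_comm,
      sub_self]
  by_cases he0 : e = 0
  · rw [he0]; exact Submodule.zero_mem _
  obtain ⟨x, ⟨hx, hxi⟩, hx0⟩ := Submodule.exists_mem_ne_zero_of_ne_bot
    (hess (Submodule.span k {e}) (isSubcomodule_iff.mpr fun m hm f' => by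
      obtain ⟨a, rfl⟩ := Submodule.mem_span_singleton.mp hm
      rw [map_smul, hact]
      exact Submodule.smul_mem _ _ (Submodule.smul_mem _ _ (Submodule.mem_span_singleton_self e)))
      (by simpa using he0))
  obtain ⟨a, rfl⟩ := Submodule.mem_span_singleton.mp hx
  exact (Submodule.smul_mem_iff _ (fun h => hx0 (by rw [h, zero_smul]))).mp hxi

end Coinvariants

end LeftComodule

namespace LeftComodule

/-! ### Cofree comodules and injectivity. -/

section Cofree

variable (k : Type u) (C : Type v) [Field k] [AddCommGroup C] [Module k C] [Coalgebra k C]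

/-- The coaction `c ⊗ m ↦ ∑ c₍₁₎ ⊗ (c₍₂₎ ⊗ m)` on `C ⊗ M`. -/
def cofreeCoact (M : Type w) [AddCommGroup M] [Module k M] :
    C ⊗[k] M →ₗ[k] C ⊗[k] (C ⊗[k] M) :=
  (TensorProduct.assoc k C C M).toLinearMap ∘ₗ (Coalgebra.comul (R := k) (A := C)).rTensor M

/-- The cofree left comodule on a vector space. -/
abbrev cofree (M : Type w) [AddCommGroup M] [Module k M] : LeftComodule k C (C ⊗[k] M) where
  coact := cofreeCoact k C M
  coassoc := by
    ext c m
    have h := Coalgebra.coassoc_apply (R := k) c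
    simp only [cofreeCoact, TensorProduct.AlgebraTensorModule.curry_apply,
      TensorProduct.curry_apply, LinearMap.coe_restrictScalars, LinearMap.comp_apply,
      LinearMap.rTensor_tmul, LinearEquiv.coe_coe]
    have h1 : ∀ p : C ⊗[k] C, TensorProduct.assoc k C C (C ⊗[k] M)
        ((Coalgebra.comul (R := k)).rTensor (C ⊗[k] M) (TensorProduct.assoc k C C M (p ⊗ₜ m))) =
        (((TensorProduct.mk k C M).flip m).lTensor C).lTensor C
          (TensorProduct.assoc k C C C ((Coalgebra.comul (R := k)).rTensor C p)) := fun p => by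
      induction p with
      | zero => simp
      | add x y hx hy => simp only [map_add, TensorProduct.add_tmul, hx, hy]
      | tmul a b =>
        simp only [TensorProduct.assoc_tmul, LinearMap.rTensor_tmul]
        generalize Coalgebra.comul (R := k) a = q
        induction q with
        | zero => simp
        | add x y hx hy => simp only [map_add, TensorProduct.add_tmul, hx, hy]
        | tmul a b => simp
    have h2 : ∀ p : C ⊗[k] C, ((TensorProduct.assoc k C C M).toLinearMap ∘ₗ
        (Coalgebra.comul (R := k)).rTensor M).lTensor C (TensorProduct.assoc k C C M (p ⊗ₜ m)) =
        (((TensorProduct.mk k C M).flip m).lTensor C).lTensor C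
          ((Coalgebra.comul (R := k)).lTensor C p) := fun p => by
      induction p with
      | zero => simp
      | add x y hx hy => simp only [map_add, TensorProduct.add_tmul, hx, hy]
      | tmul a b =>
        simp only [TensorProduct.assoc_tmul, LinearMap.lTensor_tmul, LinearMap.comp_apply,
          LinearMap.rTensor_tmul, LinearEquiv.coe_coe]
        generalize Coalgebra.comul (R := k) b = q
        induction q with
        | zero => simp
        | add x y hx hy => simp only [map_add, TensorProduct.add_tmul, TensorProduct.tmul_add, hx, hy]
        | tmul a b => simp
    rw [h1, h2, h]
  counit_coact := by
    ext c m
    have h := Coalgebra.rTensor_counit_comul (R := k) c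
    simp only [cofreeCoact, TensorProduct.AlgebraTensorModule.curry_apply,
      TensorProduct.curry_apply, LinearMap.coe_restrictScalars, LinearMap.comp_apply,
      LinearMap.rTensor_tmul, LinearEquiv.coe_coe, LinearMap.id_apply]
    have h1 : ∀ p : C ⊗[k] C, TensorProduct.lid k (C ⊗[k] M)
        ((Coalgebra.counit (R := k)).rTensor (C ⊗[k] M) (TensorProduct.assoc k C C M (p ⊗ₜ m))) =
        TensorProduct.lid k C ((Coalgebra.counit (R := k)).rTensor C p) ⊗ₜ m := fun p => by
      induction p with
      | zero => simp
      | add x y hx hy => simp only [map_add, TensorProduct.add_tmul, hx, hy]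
      | tmul a b => simp [TensorProduct.smul_tmul']
    rw [h1, h]
    simp

variable {k C}

theorem cofreeCoact_lTensor {M : Type w} {N : Type w'} [AddCommGroup M] [Module k M]
    [AddCommGroup N] [Module k N] (φ : M →ₗ[k] N) (x : C ⊗[k] M) :
    cofreeCoact k C N (φ.lTensor C x) = (φ.lTensor C).lTensor C (cofreeCoact k C M x) := by
  induction x with
  | zero => simp
  | add x y hx hy => simp only [map_add, hx, hy]
  | tmul c m =>
    simp only [cofreeCoact, LinearMap.comp_apply, LinearMap.lTensor_tmul, LinearMap.rTensor_tmul,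
      LinearEquiv.coe_coe]
    generalize Coalgebra.comul (R := k) c = p
    induction p with
    | zero => simp
    | add x y hx hy => simp only [map_add, TensorProduct.add_tmul, hx, hy]
    | tmul a b => simp

theorem cofreeCoact_coact {M : Type w} [AddCommGroup M] [Module k M] [LeftComodule k C M] (m : M) :
    cofreeCoact k C M (coact m) = (coact (k := k) (C := C)).lTensor C (coact m) :=
  LinearMap.congr_fun (coassoc (k := k) (C := C) (M := M)) m

theorem coact_injective (M : Type w) [AddCommGroup M] [Module k M] [LeftComodule k C M] :
    Function.Injective (coact (k := k) (C := C) (M := M)) :=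
  Function.LeftInverse.injective (g := leftSlice k Coalgebra.counit M) act_counit

/-- A comodule that is a retract of the cofree comodule on it is injective. -/
theorem isInjective_of_retraction {M : Type w} [AddCommGroup M] [Module k M] [LeftComodule k C M]
    (r : C ⊗[k] M →ₗ[k] M)
    (hr : ∀ x, coact (k := k) (C := C) (r x) = r.lTensor C (cofreeCoact k C M x))
    (hrc : ∀ m, r (coact m) = m) : IsInjective k C M := by
  intro X Y _ _ _ _ _ _ f g hf hinj hg
  obtain ⟨l, hl⟩ := f.exists_leftInverse_of_injective (LinearMap.ker_eq_bot.mpr hinj)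
  -- The linear extension `g ∘ₗ l` lifts to a comodule map into the cofree comodule, and `r` brings
  -- it back to `M`.
  refine ⟨r ∘ₗ (g ∘ₗ l).lTensor C ∘ₗ coact, LinearMap.ext fun y => ?_, LinearMap.ext fun x => ?_⟩
  · simp only [LinearMap.comp_apply, hr, cofreeCoact_lTensor, cofreeCoact_coact]
    simp only [LinearMap.lTensor_comp, LinearMap.comp_apply]
  · have h1 := LinearMap.congr_fun hf x
    have h2 := LinearMap.congr_fun hg x
    simp only [LinearMap.comp_apply] at h1 h2
    simp only [LinearMap.comp_apply, h1]
    rw [← LinearMap.comp_apply ((g ∘ₗ l).lTensor C), ← LinearMap.lTensor_comp,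
      LinearMap.comp_assoc, hl, LinearMap.comp_id, ← h2, hrc]

/-- The coaction embeds `M` in its cofree comodule, so the identity of `M` extends along it. `M`
shares the universe of `C` so that `C ⊗ M` is an admissible test object. -/
theorem IsInjective.exists_retraction {M : Type v} [AddCommGroup M] [Module k M]
    [LeftComodule k C M] (hM : IsInjective k C M) : ∃ r : C ⊗[k] M →ₗ[k] M,
      (∀ x, coact (k := k) (C := C) (r x) = r.lTensor C (cofreeCoact k C M x)) ∧
        ∀ m, r (coact m) = m := by
  let _ := cofree k C M
  obtain ⟨r, hr, hrc⟩ := hM M (C ⊗[k] M) coact LinearMap.id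
    (LinearMap.ext fun m => cofreeCoact_coact m) (coact_injective M) (isHom_iff.mpr fun _ _ => rfl)
  exact ⟨r, LinearMap.congr_fun hr, LinearMap.congr_fun hrc⟩

end Cofree

/-! ### Untwisting the diagonal coaction with the antipode. -/

section Twist

variable {k : Type u} {H : Type v} [Field k] [Ring H] [HopfAlgebra k H]
  {M : Type w} [AddCommGroup M] [Module k M]
  {N : Type w'} [AddCommGroup N] [Module k N]

theorem lTensor_map_mulMap {M' N' : Type*} [AddCommGroup M'] [Module k M'] [AddCommGroup N']
    [Module k N'] (φ : M →ₗ[k] M') (ψ : N →ₗ[k] N') (x : H ⊗[k] M) (y : H ⊗[k] N) :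
    (TensorProduct.map φ ψ).lTensor H (mulMap k H M N (x ⊗ₜ y)) =
      mulMap k H M' N' (φ.lTensor H x ⊗ₜ ψ.lTensor H y) := by
  induction x with
  | zero => simp
  | add x x' hx hx' => simp only [TensorProduct.add_tmul, map_add, hx, hx']
  | tmul a m =>
    induction y with
    | zero => simp
    | add y y' hy hy' => simp only [TensorProduct.tmul_add, map_add, hy, hy']
    | tmul b n => simp [mulMap_tmul]

theorem mulMap_one_tmul (m : M) (y : H ⊗[k] N) :
    mulMap k H M N ((1 ⊗ₜ m) ⊗ₜ y) = (TensorProduct.mk k M N m).lTensor H y := by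
  induction y with
  | zero => simp
  | add y y' hy hy' => simp only [TensorProduct.tmul_add, map_add, hy, hy']
  | tmul b n => simp [mulMap_tmul]

variable [LeftComodule k H N]

variable (k H M N) in
/-- The map `(H ⊗ M) ⊗ N → H ⊗ (M ⊗ N)`, `(h ⊗ m) ⊗ n ↦ ∑ h θ(n₍₋₁₎) ⊗ (m ⊗ n₍₀₎)`. -/
def twist (θ : H →ₗ[k] H) : (H ⊗[k] M) ⊗[k] N →ₗ[k] H ⊗[k] (M ⊗[k] N) :=
  mulMap k H M N ∘ₗ (θ.rTensor N ∘ₗ coact (k := k) (C := H)).lTensor (H ⊗[k] M)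

theorem twist_tmul (θ : H →ₗ[k] H) (x : H ⊗[k] M) (n : N) :
    twist k H M N θ (x ⊗ₜ n) = mulMap k H M N (x ⊗ₜ θ.rTensor N (coact n)) := rfl

theorem twist_assoc_symm_mulMap (θ : H →ₗ[k] H) (h : H) (m : M) (y : H ⊗[k] N) :
    twist k H M N θ ((TensorProduct.assoc k H M N).symm (mulMap k H M N ((h ⊗ₜ m) ⊗ₜ y))) =
      mulMap k H M N ((h ⊗ₜ m) ⊗ₜ (LinearMap.mul' k H).rTensor N
        ((TensorProduct.assoc k H H N).symm ((θ.rTensor N ∘ₗ coact).lTensor H y))) := by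
  induction y with
  | zero => simp
  | add y y' hy hy' => simp only [TensorProduct.tmul_add, map_add, hy, hy']
  | tmul b n =>
    rw [mulMap_tmul, TensorProduct.assoc_symm_tmul, twist_tmul, LinearMap.lTensor_tmul,
      LinearMap.comp_apply]
    generalize θ.rTensor N (coact n) = z
    induction z with
    | zero => simp
    | add y y' hy hy' => simp only [TensorProduct.tmul_add, map_add, hy, hy']
    | tmul b n => simp [mulMap_tmul, mul_assoc]

/-- This is `∑ n₍₋₂₎ S(n₍₋₁₎) ⊗ n₍₀₎ = 1 ⊗ n`: coassociativity reduces it to the antipode axiom, and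
the counit finishes. -/
theorem mul_antipode_coact (n : N) :
    (LinearMap.mul' k H).rTensor N ((TensorProduct.assoc k H H N).symm
      (((HopfAlgebra.antipode k).rTensor N ∘ₗ coact).lTensor H (coact (k := k) (C := H) n))) =
      1 ⊗ₜ n := by
  have hc := LinearMap.congr_fun (counit_coact (k := k) (C := H) (M := N)) n
  simp only [LinearMap.comp_apply, LinearEquiv.coe_coe, LinearMap.id_apply] at hc
  rw [LinearMap.lTensor_comp, LinearMap.comp_apply, ← cofreeCoact_coact]
  nth_rewrite 2 [← hc]
  generalize coact (k := k) (C := H) n = x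
  induction x with
  | zero => simp
  | add x y hx hy => simp only [map_add, TensorProduct.tmul_add, hx, hy]
  | tmul h n =>
    have hh := HopfAlgebra.mul_antipode_lTensor_comul_apply (R := k) h
    have h1 : ∀ p : H ⊗[k] H, (LinearMap.mul' k H).rTensor N ((TensorProduct.assoc k H H N).symm
        (((HopfAlgebra.antipode k).rTensor N).lTensor H (TensorProduct.assoc k H H N (p ⊗ₜ n)))) =
        LinearMap.mul' k H ((HopfAlgebra.antipode k).lTensor H p) ⊗ₜ n := fun p => by
      induction p with
      | zero => simp
      | add x y hx hy => simp only [map_add, TensorProduct.add_tmul, hx, hy]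
      | tmul a b => simp
    simp only [cofreeCoact, LinearMap.comp_apply, LinearEquiv.coe_coe, LinearMap.rTensor_tmul]
    rw [h1, hh, TensorProduct.lid_tmul, Algebra.algebraMap_eq_smul_one, TensorProduct.smul_tmul]

theorem mul_coact_antipode (n : N) :
    (LinearMap.mul' k H).rTensor N ((TensorProduct.assoc k H H N).symm
      (((LinearMap.id : H →ₗ[k] H).rTensor N ∘ₗ coact).lTensor H
        ((HopfAlgebra.antipode k).rTensor N (coact (k := k) (C := H) n)))) = 1 ⊗ₜ n := by
  have hc := LinearMap.congr_fun (counit_coact (k := k) (C := H) (M := N)) n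
  simp only [LinearMap.comp_apply, LinearEquiv.coe_coe, LinearMap.id_apply] at hc
  rw [LinearMap.rTensor_id, LinearMap.id_comp, ← LinearMap.comp_apply (LinearMap.lTensor _ _),
    LinearMap.lTensor_comp_rTensor, ← LinearMap.rTensor_comp_lTensor, LinearMap.comp_apply,
    ← cofreeCoact_coact]
  nth_rewrite 2 [← hc]
  generalize coact (k := k) (C := H) n = x
  induction x with
  | zero => simp
  | add x y hx hy => simp only [map_add, TensorProduct.tmul_add, hx, hy]
  | tmul h n =>
    have hh := HopfAlgebra.mul_antipode_rTensor_comul_apply (R := k) h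
    have h1 : ∀ p : H ⊗[k] H, (LinearMap.mul' k H).rTensor N ((TensorProduct.assoc k H H N).symm
        ((HopfAlgebra.antipode k).rTensor (H ⊗[k] N) (TensorProduct.assoc k H H N (p ⊗ₜ n)))) =
        LinearMap.mul' k H ((HopfAlgebra.antipode k).rTensor H p) ⊗ₜ n := fun p => by
      induction p with
      | zero => simp
      | add x y hx hy => simp only [map_add, TensorProduct.add_tmul, hx, hy]
      | tmul a b => simp
    simp only [cofreeCoact, LinearMap.comp_apply, LinearEquiv.coe_coe, LinearMap.rTensor_tmul]
    rw [h1, hh, TensorProduct.lid_tmul, Algebra.algebraMap_eq_smul_one, TensorProduct.smul_tmul]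

variable (k H M N) in
/-- The map `H ⊗ (M ⊗ N) → (H ⊗ M) ⊗ N`, `h ⊗ (m ⊗ n) ↦ ∑ (h S(n₍₋₁₎) ⊗ m) ⊗ n₍₀₎`. -/
def untwist : H ⊗[k] (M ⊗[k] N) →ₗ[k] (H ⊗[k] M) ⊗[k] N :=
  (TensorProduct.assoc k H M N).symm.toLinearMap ∘ₗ twist k H M N (HopfAlgebra.antipode k) ∘ₗ
    (TensorProduct.assoc k H M N).symm.toLinearMap

theorem untwist_twist (x : (H ⊗[k] M) ⊗[k] N) :
    untwist k H M N (twist k H M N LinearMap.id x) = x := by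
  suffices h : untwist k H M N ∘ₗ twist k H M N LinearMap.id = LinearMap.id from
    LinearMap.congr_fun h x
  refine TensorProduct.ext_threefold fun h m n => ?_
  simp only [untwist, LinearMap.comp_apply, LinearEquiv.coe_coe, LinearMap.id_apply]
  rw [twist_tmul, twist_assoc_symm_mulMap, LinearMap.rTensor_id, LinearMap.id_apply,
    mul_antipode_coact, mulMap_tmul, mul_one, TensorProduct.assoc_symm_tmul]

theorem twist_untwist (x : H ⊗[k] (M ⊗[k] N)) :
    twist k H M N LinearMap.id (untwist k H M N x) = x := by
  obtain ⟨x, rfl⟩ := (TensorProduct.assoc k H M N).surjective x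
  suffices h : twist k H M N LinearMap.id ∘ₗ untwist k H M N ∘ₗ
      (TensorProduct.assoc k H M N).toLinearMap = (TensorProduct.assoc k H M N).toLinearMap from
    LinearMap.congr_fun h x
  refine TensorProduct.ext_threefold fun h m n => ?_
  simp only [untwist, LinearMap.comp_apply, LinearEquiv.coe_coe, LinearEquiv.symm_apply_apply]
  rw [twist_tmul, twist_assoc_symm_mulMap, mul_coact_antipode, mulMap_tmul, mul_one,
    TensorProduct.assoc_tmul]

/-- Colinearity of the twist, from the diagonal coaction on `(H ⊗ M) ⊗ N`, with `H ⊗ M` cofree, to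
the cofree coaction on `H ⊗ (M ⊗ N)`. -/
theorem cofreeCoact_twist (x : H ⊗[k] M) (n : N) :
    cofreeCoact k H (M ⊗[k] N) (twist k H M N LinearMap.id (x ⊗ₜ n)) =
      (twist k H M N LinearMap.id).lTensor H
        (mulMap k H (H ⊗[k] M) N (cofreeCoact k H M x ⊗ₜ coact n)) := by
  rw [twist_tmul, LinearMap.rTensor_id, LinearMap.id_apply]
  have h := assoc_comul_mulMap k H M N x (coact n)
  have h2 : TensorProduct.assoc k H H N ((Coalgebra.comul (R := k)).rTensor N (coact n)) =
    coact.lTensor H (coact n) := cofreeCoact_coact n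
  rw [h2] at h
  refine h.trans ?_
  have h3 := lTensor_map_mulMap (LinearMap.id) (coact (k := k) (C := H) (M := N))
    (cofreeCoact k H M x) (coact n)
  rw [LinearMap.lTensor_id, LinearMap.id_apply] at h3
  rw [twist, LinearMap.rTensor_id, LinearMap.id_comp, LinearMap.lTensor_comp, LinearMap.comp_apply]
  exact congrArg _ h3.symm

/-- The diagonal coaction is by definition the twist of `coact ⊗ id`. Untwisting it therefore
isolates the coaction of `M`, which serves both injectivity and essentiality. -/
theorem untwist_coact [LeftComodule k H M] (x : M ⊗[k] N) :
    untwist k H M N (coact (k := k) (C := H) x) =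
      (coact (k := k) (C := H)).rTensor N x := by
  rw [← untwist_twist (LinearMap.rTensor N coact x)]
  congr 1
  induction x with
  | zero => simp
  | add x y hx hy => simp only [map_add, hx, hy]
  | tmul m n =>
    rw [LinearMap.rTensor_tmul, twist_tmul, LinearMap.rTensor_id]
    rfl

/-- The tensor product of an injective comodule with any comodule is injective. -/
theorem IsInjective.tensor {E S : Type v} [AddCommGroup E] [Module k E] [LeftComodule k H E]
    [AddCommGroup S] [Module k S] [LeftComodule k H S] (hE : IsInjective k H E) :
    IsInjective k H (E ⊗[k] S) := by
  obtain ⟨r, hr, hrc⟩ := hE.exists_retraction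
  refine isInjective_of_retraction (r.rTensor S ∘ₗ untwist k H E S) (fun x => ?_) fun x => ?_
  · rw [← twist_untwist x]
    generalize untwist k H E S x = y
    rw [LinearMap.comp_apply, untwist_twist]
    induction y with
    | zero => simp
    | add x y hx hy => simp only [map_add, hx, hy]
    | tmul x s =>
      have h1 : (r.rTensor S ∘ₗ untwist k H E S) ∘ₗ twist k H E S LinearMap.id = r.rTensor S :=
        LinearMap.ext fun z => by simp only [LinearMap.comp_apply, untwist_twist]
      rw [cofreeCoact_twist, ← LinearMap.comp_apply (LinearMap.lTensor _ _),
        ← LinearMap.lTensor_comp, h1, LinearMap.rTensor, lTensor_map_mulMap, ← hr,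
        LinearMap.lTensor_id]
      rfl
  · rw [LinearMap.comp_apply, untwist_coact, ← LinearMap.comp_apply, ← LinearMap.rTensor_comp,
      show r ∘ₗ coact = LinearMap.id from LinearMap.ext hrc, LinearMap.rTensor_id]
    rfl

end Twist

end LeftComodule

namespace LeftComodule

/-! ### The envelope of a simple comodule. -/

section EnvelopeTensor

variable {k : Type u} {H : Type v} [Field k] [Ring H] [HopfAlgebra k H]
  {E S : Type v} [AddCommGroup E] [Module k E] [LeftComodule k H E]
  [AddCommGroup S] [Module k S] [LeftComodule k H S]

/-- If `A` is closed under products and the antipode and contains the coefficients of `S`, then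
the slices in `E` of a vector of `E ⊗ S` with coefficients in `A` have coefficients in `A`. -/
theorem rightSlice_mem_coeffSubmodule {A : Submodule k H} (hmul : ∀ a ∈ A, ∀ b ∈ A, a * b ∈ A)
    (hanti : ∀ a ∈ A, HopfAlgebra.antipode k a ∈ A) (hS : coeffSubmodule A S = ⊤)
    {t : E ⊗[k] S} (ht : t ∈ coeffSubmodule A (E ⊗[k] S)) (g : Module.Dual k S) :
    rightSlice k E g t ∈ coeffSubmodule A E := by
  rw [mem_coeffSubmodule_iff_coact] at ht ⊢
  -- The coaction of the slice is a slice of the untwisted diagonal coaction, whose left factors are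
  -- products `c * S(a)` with `c` and `a` in `A`.
  rw [← rightSlice_rTensor, ← untwist_coact]
  obtain ⟨z, hz⟩ := ht
  rw [← hz]
  clear hz
  induction z with
  | zero => simp
  | add x y hx hy => simp only [map_add]; exact Submodule.add_mem _ hx hy
  | tmul c y =>
    induction y with
    | zero => simp
    | add x y hx hy =>
      simp only [TensorProduct.tmul_add, map_add]; exact Submodule.add_mem _ hx hy
    | tmul e s =>
      obtain ⟨z, hz⟩ := mem_coeffSubmodule_iff_coact.mp (hS.symm.le (Submodule.mem_top (x := s)))
      simp only [untwist, LinearMap.comp_apply, LinearMap.rTensor_tmul, LinearEquiv.coe_coe,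
        TensorProduct.assoc_symm_tmul, twist_tmul, ← hz, Submodule.subtype_apply]
      clear hz
      induction z with
      | zero => simp
      | add x y hx hy =>
        simp only [TensorProduct.tmul_add, map_add]; exact Submodule.add_mem _ hx hy
      | tmul a s =>
        simp only [LinearMap.rTensor_tmul, mulMap_tmul, TensorProduct.assoc_symm_tmul,
          rightSlice_tmul, Submodule.subtype_apply]
        exact Submodule.smul_mem _ _
          ⟨⟨_, hmul c c.2 _ (hanti a a.2)⟩ ⊗ₜ e, LinearMap.rTensor_tmul _ _ _ _⟩

theorem IsInjectiveEnvelope.tensor_simple (hH : IsHopfSubalgebra k (coradical k H))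
    {i : k →ₗ[k] E} (hE : IsInjectiveEnvelope k H i) (hS : IsSimple k H S) :
    IsInjectiveEnvelope k H (TensorProduct.mk k E S (i 1)) where
  isInjective := hE.isInjective.tensor
  isHom := LinearMap.ext fun s => by
    refine Eq.trans (b := mulMap k H E S (coact (i 1) ⊗ₜ coact s)) rfl ?_
    rw [coact_of_isHom_trivial hE.isHom, mulMap_one_tmul]
    rfl
  injective := by
    have hi1 : i 1 ≠ 0 := fun h => one_ne_zero (hE.injective (h.trans (map_zero i).symm))
    obtain ⟨f, hf, -⟩ := exists_dual_apply_eq_one (D := (⊥ : Submodule k E)) (x := i 1) hi1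
    exact Function.LeftInverse.injective (g := leftSlice k f S) fun s => by simp [hf]
  essential N hN hN0 := by
    obtain ⟨t, htN, ht0, ht⟩ := exists_ne_zero_mem_coeffSubmodule_coradical hN hN0
    refine fun h => ht0 ((Submodule.eq_bot_iff _).mp h t ⟨htN, ?_⟩)
    -- All slices of `t` along `S` have coefficients in the coradical, hence lie in the image of
    -- `k`.
    have hrange : t ∈ LinearMap.range ((LinearMap.range i).subtype.rTensor S) :=
      mem_range_rTensor_subtype_iff.mpr fun g =>
        coeffSubmodule_coradical_le_range hE.isHom hE.injective hE.essential
          (rightSlice_mem_coeffSubmodule hH.mul_mem hH.antipode_mem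
            (hS.coeffSubmodule_coradical_eq_top hH.isSubcoalgebra) ht g)
    obtain ⟨y, rfl⟩ := hrange
    clear ht ht0 htN
    induction y with
    | zero => simp
    | add x y hx hy => rw [map_add]; exact Submodule.add_mem _ hx hy
    | tmul x s =>
      obtain ⟨_, c, rfl⟩ := x
      refine ⟨c • s, ?_⟩
      rw [TensorProduct.mk_apply, ← TensorProduct.smul_tmul, ← map_smul, smul_eq_mul, mul_one]
      rfl

end EnvelopeTensor

end LeftComodule

end

theorem mainTheorem10 {k : Type u} {H : Type v} [Field k] [Ring H] [HopfAlgebra k H]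
    (hH : IsHopfSubalgebra k (coradical k H))
    {E : Type v} [AddCommGroup E] [Module k E] [LeftComodule k H E]
    (i : k →ₗ[k] E) (hE : LeftComodule.IsInjectiveEnvelope k H i)
    {S : Type v} [AddCommGroup S] [Module k S] [LeftComodule k H S]
    (hS : LeftComodule.IsSimple k H S)
    {ES : Type v} [AddCommGroup ES] [Module k ES] [LeftComodule k H ES]
    (j : S →ₗ[k] ES) (hES : LeftComodule.IsInjectiveEnvelope k H j) :
    ∃ e : ES ≃ₗ[k] E ⊗[k] S, LeftComodule.IsHom k H e.toLinearMap :=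
  hES.exists_equiv (hE.tensor_simple hH hS)
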